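/- An $\ell$-group is a lattice-ordered group $G$, written additively and not necessarily Abelian; an $\ell$-homomorphism is a group homomorphism that is also a lattice homomorphism. A convex $\ell$-subgroup of $G$ is a subgroup that is an order-convex sublattice; an $\ell$-ideal is a normal convex $\ell$-subgroup. Denote by $\operatorname{Cs}_c G$ (resp. $\operatorname{Id}_c G$) the set of all finitely generated convex $\ell$-subgroups (resp. finitely generated $\ell$-ideals) of $G$, ordered by inclusion; for an $\ell$-homomorphism $f\colon G\to H$, the map $\operatorname{Cs}_c f$ (resp. $\operatorname{Id}_c f$) sends $S$ to the convex $\ell$-subgroup (resp. $\ell$-ideal) of $H$ generated by $f[S]$. The poset $\operatorname{Cs}_c G$ is a distributive lattice with zero, and so is $\operatorname{Id}_c G$ if $G$ is representable (i.e., a subdirect product of totally ordered groups), in particular if $G$ is Abelian, in which case $\operatorname{Cs}_cG=\operatorname{Id}_cG$. A $0$-lattice homomorphism is a lattice homomorphism that preserves $0$. Let $\mathfrak{P}[3]$ be the powerset of $\{1,2,3\}$, ordered by inclusion; write $12$ for $\{1,2\}$, and so on. Let $A_{123}$ be the Abelian $\ell$-group defined by the generators $a,a',b,c$ and the relations $0\le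 a\le a'\le 2a$, $0\le b$, $0\le c$. Let $A_{12}$, $A_{13}$, $A_{23}$, $A_1$, $A_2$, $A_3$ be the $\ell$-subgroups of $A_{123}$ generated by $\{a,b\}$, $\{a',c\}$, $\{b,c\}$, $\{a\}$, $\{b\}$, $\{c\}$, respectively, and let $A_\varnothing=\{0\}$. Let $\vec A$ be the (non-commutative) $\mathfrak{P}[3]$-indexed diagram with vertices $A_p$ whose only arrow from $A_p$ to $A_q$, for $p\subseteq q$, is the inclusion map, except that the only arrow from $A_1$ to $A_{13}$ is the $\ell$-homomorphism sending $a$ to $a'$, and that there are two arrows from $A_1$ to $A_{123}$, namely the inclusion map and the $\ell$-homomorphism sending $a$ to $a'$. Applying $\operatorname{Id}_c$ to the vertices and arrows of $\vec A$ yields a commutative diagram $\operatorname{Id}_c\vec A$ of distributive lattices with zero and $0$-lattice homomorphisms. **Theorem.** Let $\vec G=(G_p,\gamma_p^q\mid p\subseteq q\text{ in }\mathfrak{P}[3])$ be a commutative diagram of $\ell$-groups and $\ell$-homomorphisms. Let $\vec\eta=(\eta_p\mid p\in\mathfrak{P}[3])$ be a natural transformation, consisting of $0$-lattice homomorphisms,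 either 1. from $\operatorname{Cs}_c\vec G$ to $\operatorname{Id}_c\vec A$, or 2. from $\operatorname{Id}_c\vec G$ to $\operatorname{Id}_c\vec A$, in case all the $\ell$-groups $G_p$ are representable. Then $\eta_i=0$ for some $i\in\{1,2,3\}$. -/

import Mathlib

/-! ### Lattice-ordered groups, their homomorphisms, convex `ℓ`-subgroups and `ℓ`-ideals

An `ℓ`-group (written additively, not necessarily commutative) is a type with
`[AddGroup G] [Lattice G] [AddLeftMono G] [AddRightMono G]`. -/

/-- An `ℓ`-homomorphism: a group homomorphism that is also a lattice homomorphism. -/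
structure LGroupHom (G : Type*) (H : Type*) [AddGroup G] [Lattice G] [AddGroup H] [Lattice H]
    extends G →+ H where
  map_sup' : ∀ x y : G, toFun (x ⊔ y) = toFun x ⊔ toFun y
  map_inf' : ∀ x y : G, toFun (x ⊓ y) = toFun x ⊓ toFun y

section Ideals

variable {G : Type*} [AddGroup G] [Lattice G] {H : Type*} [AddGroup H] [Lattice H]

instance : CoeFun (LGroupHom G H) (fun _ => G → H) := ⟨fun f => f.toAddMonoidHom⟩

/-- A subgroup is an `ℓ`-subgroup if it is also a sublattice. -/
def IsLSubgroup (S : AddSubgroup G) : Prop :=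
  ∀ x ∈ S, ∀ y ∈ S, x ⊔ y ∈ S ∧ x ⊓ y ∈ S

/-- Convex `ℓ`-subgroups. -/
def IsConvexLSubgroup (S : AddSubgroup G) : Prop :=
  IsLSubgroup S ∧ (S : Set G).OrdConnected

/-- `ℓ`-ideals, that is, normal convex `ℓ`-subgroups. -/
def IsLIdeal (S : AddSubgroup G) : Prop :=
  IsConvexLSubgroup S ∧ S.Normal

/-- The `ℓ`-subgroup generated by a set. -/
def lClosure (X : Set G) : AddSubgroup G :=
  sInf {S | IsLSubgroup S ∧ X ⊆ S}

/-- The convex `ℓ`-subgroup generated by a set. -/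
def convexLClosure (X : Set G) : AddSubgroup G :=
  sInf {S | IsConvexLSubgroup S ∧ X ⊆ S}

/-- The `ℓ`-ideal generated by a set. -/
def lIdealClosure (X : Set G) : AddSubgroup G :=
  sInf {S | IsLIdeal S ∧ X ⊆ S}

lemma isLSubgroup_sInf {𝒮 : Set (AddSubgroup G)} (h : ∀ S ∈ 𝒮, IsLSubgroup S) :
    IsLSubgroup (sInf 𝒮) := by
  intro x hx y hy
  simp only [AddSubgroup.mem_sInf] at hx hy ⊢
  exact ⟨fun S hS => (h S hS x (hx S hS) y (hy S hS)).1,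
    fun S hS => (h S hS x (hx S hS) y (hy S hS)).2⟩

lemma isConvexLSubgroup_sInf {𝒮 : Set (AddSubgroup G)} (h : ∀ S ∈ 𝒮, IsConvexLSubgroup S) :
    IsConvexLSubgroup (sInf 𝒮) := by
  refine ⟨isLSubgroup_sInf fun S hS => (h S hS).1, ⟨fun x hx y hy z hz => ?_⟩⟩
  simp only [SetLike.mem_coe, AddSubgroup.mem_sInf] at hx hy ⊢
  exact fun S hS => (h S hS).2.out (hx S hS) (hy S hS) hz

lemma isLIdeal_sInf {𝒮 : Set (AddSubgroup G)} (h : ∀ S ∈ 𝒮, IsLIdeal S) :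
    IsLIdeal (sInf 𝒮) := by
  refine ⟨isConvexLSubgroup_sInf fun S hS => (h S hS).1, ⟨fun x hx g => ?_⟩⟩
  simp only [AddSubgroup.mem_sInf] at hx ⊢
  exact fun S hS => (h S hS).2.conj_mem x (hx S hS) g

lemma isLSubgroup_lClosure (X : Set G) : IsLSubgroup (lClosure X) :=
  isLSubgroup_sInf fun _ hS => hS.1

lemma isConvexLSubgroup_convexLClosure (X : Set G) : IsConvexLSubgroup (convexLClosure X) :=
  isConvexLSubgroup_sInf fun _ hS => hS.1

lemma isLIdeal_lIdealClosure (X : Set G) : IsLIdeal (lIdealClosure X) :=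
  isLIdeal_sInf fun _ hS => hS.1

lemma subset_lClosure (X : Set G) : X ⊆ lClosure X :=
  fun _ hx => AddSubgroup.mem_sInf.2 fun _ hS => hS.2 hx

lemma subset_convexLClosure (X : Set G) : X ⊆ convexLClosure X :=
  fun _ hx => AddSubgroup.mem_sInf.2 fun _ hS => hS.2 hx

lemma subset_lIdealClosure (X : Set G) : X ⊆ lIdealClosure X :=
  fun _ hx => AddSubgroup.mem_sInf.2 fun _ hS => hS.2 hx

lemma lClosure_le {X : Set G} {S : AddSubgroup G} (hS : IsLSubgroup S) (h : X ⊆ S) :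
    lClosure X ≤ S := sInf_le ⟨hS, h⟩

lemma convexLClosure_le {X : Set G} {S : AddSubgroup G} (hS : IsConvexLSubgroup S) (h : X ⊆ S) :
    convexLClosure X ≤ S := sInf_le ⟨hS, h⟩

lemma lIdealClosure_le {X : Set G} {S : AddSubgroup G} (hS : IsLIdeal S) (h : X ⊆ S) :
    lIdealClosure X ≤ S := sInf_le ⟨hS, h⟩

lemma LGroupHom.isLSubgroup_comap (f : LGroupHom G H) {S : AddSubgroup H} (hS : IsLSubgroup S) :
    IsLSubgroup (S.comap f.toAddMonoidHom) := by
  intro x hx y hy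
  refine ⟨?_, ?_⟩
  · change f.toFun (x ⊔ y) ∈ S
    rw [f.map_sup']
    exact (hS _ hx _ hy).1
  · change f.toFun (x ⊓ y) ∈ S
    rw [f.map_inf']
    exact (hS _ hx _ hy).2

lemma LGroupHom.mono (f : LGroupHom G H) {x y : G} (h : x ≤ y) : f x ≤ f y := by
  have := f.map_sup' x y
  rw [sup_eq_right.2 h] at this
  exact le_of_le_of_eq le_sup_left this.symm

lemma LGroupHom.isConvexLSubgroup_comap (f : LGroupHom G H) {S : AddSubgroup H}
    (hS : IsConvexLSubgroup S) : IsConvexLSubgroup (S.comap f.toAddMonoidHom) :=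
  ⟨f.isLSubgroup_comap hS.1,
    ⟨fun _ hx _ hy _ hz => hS.2.out hx hy ⟨f.mono hz.1, f.mono hz.2⟩⟩⟩

lemma LGroupHom.isLIdeal_comap (f : LGroupHom G H) {S : AddSubgroup H} (hS : IsLIdeal S) :
    IsLIdeal (S.comap f.toAddMonoidHom) :=
  ⟨f.isConvexLSubgroup_comap hS.1, hS.2.comap _⟩

lemma convexLClosure_image (f : LGroupHom G H) (X : Set G) :
    convexLClosure (f '' (convexLClosure X : Set G)) = convexLClosure (f '' X) := by
  apply le_antisymm
  · refine convexLClosure_le (isConvexLSubgroup_convexLClosure _) (Set.image_subset_iff.2 ?_)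
    exact convexLClosure_le (f.isConvexLSubgroup_comap (isConvexLSubgroup_convexLClosure _))
      (fun _ hx => subset_convexLClosure (f '' X) (Set.mem_image_of_mem f hx))
  · exact convexLClosure_le (isConvexLSubgroup_convexLClosure _)
      ((Set.image_mono (subset_convexLClosure X)).trans (subset_convexLClosure _))

lemma lIdealClosure_image (f : LGroupHom G H) (X : Set G) :
    lIdealClosure (f '' (lIdealClosure X : Set G)) = lIdealClosure (f '' X) := by
  apply le_antisymm
  · refine lIdealClosure_le (isLIdeal_lIdealClosure _) (Set.image_subset_iff.2 ?_)
    exact lIdealClosure_le (f.isLIdeal_comap (isLIdeal_lIdealClosure _))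
      (fun _ hx => subset_lIdealClosure (f '' X) (Set.mem_image_of_mem f hx))
  · exact lIdealClosure_le (isLIdeal_lIdealClosure _)
      ((Set.image_mono (subset_lIdealClosure X)).trans (subset_lIdealClosure _))

variable (G) in
/-- The finitely generated convex `ℓ`-subgroups of `G`, ordered by inclusion. -/
def Csc : Type _ := {S : AddSubgroup G // ∃ X : Set G, X.Finite ∧ S = convexLClosure X}

variable (G) in
/-- The finitely generated `ℓ`-ideals of `G`, ordered by inclusion. -/
def Idc : Type _ := {S : AddSubgroup G // ∃ X : Set G, X.Finite ∧ S = lIdealClosure X}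

instance : PartialOrder (Csc G) := Subtype.partialOrder _

instance : PartialOrder (Idc G) := Subtype.partialOrder _

lemma isLIdeal_bot : IsLIdeal (⊥ : AddSubgroup G) := by
  refine ⟨⟨?_, ⟨?_⟩⟩, inferInstance⟩
  · intro x hx y hy
    simp only [AddSubgroup.mem_bot] at *
    subst hx hy
    simp
  · intro x hx y hy z hz
    simp only [AddSubgroup.coe_bot, Set.mem_singleton_iff] at *
    subst hx hy
    exact le_antisymm hz.2 hz.1

/-- The zero of `Csc G` is the trivial subgroup. -/
instance : OrderBot (Csc G) where
  bot := ⟨⊥, ∅, Set.finite_empty,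
    (le_bot_iff.1 (convexLClosure_le isLIdeal_bot.1 (Set.empty_subset _))).symm⟩
  bot_le S := (bot_le : (⊥ : AddSubgroup G) ≤ S.1)

/-- The zero of `Idc G` is the trivial subgroup. -/
instance : OrderBot (Idc G) where
  bot := ⟨⊥, ∅, Set.finite_empty,
    (le_bot_iff.1 (lIdealClosure_le isLIdeal_bot (Set.empty_subset _))).symm⟩
  bot_le S := (bot_le : (⊥ : AddSubgroup G) ≤ S.1)

/-- The action of the functor `Csc` on `ℓ`-homomorphisms: `S` is sent to the convex
`ℓ`-subgroup generated by its image. -/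
def Csc.map (f : LGroupHom G H) (S : Csc G) : Csc H :=
  ⟨convexLClosure (f '' (S.1 : Set G)), by
    obtain ⟨X, hX, h⟩ := S.2
    exact ⟨f '' X, hX.image _, by rw [h, convexLClosure_image]⟩⟩

/-- The action of the functor `Idc` on `ℓ`-homomorphisms: `S` is sent to the
`ℓ`-ideal generated by its image. -/
def Idc.map (f : LGroupHom G H) (S : Idc G) : Idc H :=
  ⟨lIdealClosure (f '' (S.1 : Set G)), by
    obtain ⟨X, hX, h⟩ := S.2
    exact ⟨f '' X, hX.image _, by rw [h, lIdealClosure_image]⟩⟩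

end Ideals

/-- A map preserving the least element, binary joins and binary meets. -/
structure IsZeroLatticeHom {D E : Type*} [PartialOrder D] [OrderBot D] [PartialOrder E]
    [OrderBot E] (f : D → E) : Prop where
  map_bot : f ⊥ = ⊥
  map_join : ∀ x y z : D, IsLUB {x, y} z → IsLUB {f x, f y} (f z)
  map_meet : ∀ x y z : D, IsGLB {x, y} z → IsGLB {f x, f y} (f z)

/-- On lattices, `IsZeroLatticeHom` has its usual equational meaning. -/
lemma isZeroLatticeHom_iff {D E : Type*} [Lattice D] [OrderBot D] [Lattice E] [OrderBot E]
    (f : D → E) : IsZeroLatticeHom f ↔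
      f ⊥ = ⊥ ∧ (∀ x y, f (x ⊔ y) = f x ⊔ f y) ∧ (∀ x y, f (x ⊓ y) = f x ⊓ f y) := by
  constructor
  · rintro ⟨h0, h1, h2⟩
    exact ⟨h0, fun x y => (h1 x y _ isLUB_pair).unique isLUB_pair,
      fun x y => (h2 x y _ isGLB_pair).unique isGLB_pair⟩
  · rintro ⟨h0, h1, h2⟩
    refine ⟨h0, fun x y z h => ?_, fun x y z h => ?_⟩
    · rw [h.unique isLUB_pair, h1]
      exact isLUB_pair
    · rw [h.unique isGLB_pair, h2]
      exact isGLB_pair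

/-- An `ℓ`-group is representable if it is a subdirect product of totally ordered groups. -/
def IsRepresentable.{u} (G : Type u) [AddGroup G] [Lattice G] : Prop :=
  ∃ (I : Type u) (T : I → Type u) (_ : ∀ i, AddGroup (T i)) (_ : ∀ i, LinearOrder (T i))
    (f : ∀ i, LGroupHom G (T i)),
    (∀ i, AddLeftMono (T i) ∧ AddRightMono (T i)) ∧
    (∀ i, Function.Surjective (f i)) ∧
    ∀ x : G, (∀ i, f i x = 0) → x = 0

/-! ### Abelian `ℓ`-groups given by generators and relations -/

/-- Terms in the similarity type `(0, +, -, ⊔, ⊓)`. -/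
inductive LTerm (X : Type*) : Type _
  | var : X → LTerm X
  | zero : LTerm X
  | add : LTerm X → LTerm X → LTerm X
  | neg : LTerm X → LTerm X
  | sup : LTerm X → LTerm X → LTerm X
  | inf : LTerm X → LTerm X → LTerm X

/-- The least congruence on terms that contains the relations `R` and the axioms of
Abelian `ℓ`-groups. -/
inductive LTerm.Rel {X : Type*} (R : LTerm X → LTerm X → Prop) : LTerm X → LTerm X → Prop
  | of {s t : LTerm X} : R s t → LTerm.Rel R s t
  | refl (s : LTerm X) : LTerm.Rel R s s
  | symm {s t : LTerm X} : LTerm.Rel R s t → LTerm.Rel R t s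
  | trans {s t u : LTerm X} : LTerm.Rel R s t → LTerm.Rel R t u → LTerm.Rel R s u
  | add_congr {s s' t t' : LTerm X} : LTerm.Rel R s s' → LTerm.Rel R t t' →
      LTerm.Rel R (s.add t) (s'.add t')
  | neg_congr {s s' : LTerm X} : LTerm.Rel R s s' → LTerm.Rel R s.neg s'.neg
  | sup_congr {s s' t t' : LTerm X} : LTerm.Rel R s s' → LTerm.Rel R t t' →
      LTerm.Rel R (s.sup t) (s'.sup t')
  | inf_congr {s s' t t' : LTerm X} : LTerm.Rel R s s' → LTerm.Rel R t t' →
      LTerm.Rel R (s.inf t) (s'.inf t')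
  | add_assoc (s t u : LTerm X) : LTerm.Rel R ((s.add t).add u) (s.add (t.add u))
  | add_comm (s t : LTerm X) : LTerm.Rel R (s.add t) (t.add s)
  | zero_add (s : LTerm X) : LTerm.Rel R (LTerm.zero.add s) s
  | neg_add (s : LTerm X) : LTerm.Rel R (s.neg.add s) LTerm.zero
  | sup_comm (s t : LTerm X) : LTerm.Rel R (s.sup t) (t.sup s)
  | sup_assoc (s t u : LTerm X) : LTerm.Rel R ((s.sup t).sup u) (s.sup (t.sup u))
  | inf_comm (s t : LTerm X) : LTerm.Rel R (s.inf t) (t.inf s)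
  | inf_assoc (s t u : LTerm X) : LTerm.Rel R ((s.inf t).inf u) (s.inf (t.inf u))
  | sup_inf_self (s t : LTerm X) : LTerm.Rel R (s.sup (s.inf t)) s
  | inf_sup_self (s t : LTerm X) : LTerm.Rel R (s.inf (s.sup t)) s
  | add_sup (s t u : LTerm X) : LTerm.Rel R (s.add (t.sup u)) ((s.add t).sup (s.add u))

/-- The congruence `LTerm.Rel R` as a setoid. -/
def LTerm.setoid {X : Type*} (R : LTerm X → LTerm X → Prop) : Setoid (LTerm X) :=
  ⟨LTerm.Rel R, LTerm.Rel.refl, LTerm.Rel.symm, LTerm.Rel.trans⟩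

/-- The Abelian `ℓ`-group defined by the generators `X` and the relations `R`. -/
def PresentedLGroup {X : Type*} (R : LTerm X → LTerm X → Prop) : Type _ :=
  Quotient (LTerm.setoid R)

namespace PresentedLGroup

variable {X : Type*} {R : LTerm X → LTerm X → Prop}

/-- The canonical generators. -/
def of (x : X) : PresentedLGroup R := Quotient.mk (LTerm.setoid R) (LTerm.var x)

instance : AddCommGroup (PresentedLGroup R) where
  zero := Quotient.mk (LTerm.setoid R) LTerm.zero
  add := Quotient.map₂ LTerm.add (fun _ _ h _ _ h' => LTerm.Rel.add_congr h h')
  neg := Quotient.map LTerm.neg (fun _ _ h => LTerm.Rel.neg_congr h)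
  nsmul := @nsmulRec _ ⟨Quotient.mk (LTerm.setoid R) LTerm.zero⟩
    ⟨Quotient.map₂ LTerm.add (fun _ _ h _ _ h' => LTerm.Rel.add_congr h h')⟩
  zsmul := @zsmulRec _ ⟨Quotient.mk (LTerm.setoid R) LTerm.zero⟩
    ⟨Quotient.map₂ LTerm.add (fun _ _ h _ _ h' => LTerm.Rel.add_congr h h')⟩
    ⟨Quotient.map LTerm.neg (fun _ _ h => LTerm.Rel.neg_congr h)⟩
    (@nsmulRec _ ⟨Quotient.mk (LTerm.setoid R) LTerm.zero⟩
      ⟨Quotient.map₂ LTerm.add (fun _ _ h _ _ h' => LTerm.Rel.add_congr h h')⟩)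
  add_assoc := by
    rintro ⟨s⟩ ⟨t⟩ ⟨u⟩
    exact Quotient.sound (LTerm.Rel.add_assoc s t u)
  zero_add := by
    rintro ⟨s⟩
    exact Quotient.sound (LTerm.Rel.zero_add s)
  add_zero := by
    rintro ⟨s⟩
    exact Quotient.sound ((LTerm.Rel.add_comm _ _).trans (LTerm.Rel.zero_add s))
  neg_add_cancel := by
    rintro ⟨s⟩
    exact Quotient.sound (LTerm.Rel.neg_add s)
  add_comm := by
    rintro ⟨s⟩ ⟨t⟩
    exact Quotient.sound (LTerm.Rel.add_comm s t)

/-- The order is the one of the lattice operations: `x ≤ y ↔ x ⊔ y = y`. -/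
instance : Lattice (PresentedLGroup R) :=
  @Lattice.mk' _
    ⟨Quotient.map₂ LTerm.sup (fun _ _ h _ _ h' => LTerm.Rel.sup_congr h h')⟩
    ⟨Quotient.map₂ LTerm.inf (fun _ _ h _ _ h' => LTerm.Rel.inf_congr h h')⟩
    (by rintro ⟨s⟩ ⟨t⟩; exact Quotient.sound (LTerm.Rel.sup_comm s t))
    (by rintro ⟨s⟩ ⟨t⟩ ⟨u⟩; exact Quotient.sound (LTerm.Rel.sup_assoc s t u))
    (by rintro ⟨s⟩ ⟨t⟩; exact Quotient.sound (LTerm.Rel.inf_comm s t))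
    (by rintro ⟨s⟩ ⟨t⟩ ⟨u⟩; exact Quotient.sound (LTerm.Rel.inf_assoc s t u))
    (by rintro ⟨s⟩ ⟨t⟩; exact Quotient.sound (LTerm.Rel.sup_inf_self s t))
    (by rintro ⟨s⟩ ⟨t⟩; exact Quotient.sound (LTerm.Rel.inf_sup_self s t))

lemma add_sup_eq (x y z : PresentedLGroup R) : x + (y ⊔ z) = (x + y) ⊔ (x + z) := by
  obtain ⟨s⟩ := x
  obtain ⟨t⟩ := y
  obtain ⟨u⟩ := z
  exact Quotient.sound (LTerm.Rel.add_sup s t u)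

instance : IsOrderedAddMonoid (PresentedLGroup R) where
  add_le_add_left x y h z := by
    rw [← sup_eq_right] at h ⊢
    rw [add_comm x z, add_comm y z, ← add_sup_eq, h]

end PresentedLGroup

/-! ### The non-commutative diagram `A` -/

/-- The four generators `a`, `a'`, `b`, `c`. -/
inductive AGen : Type
  | a | a' | b | c

/-- The relations `0 ≤ a ≤ a' ≤ 2a`, `0 ≤ b`, `0 ≤ c`; here `s ≤ t` is written `s ⊓ t = s`. -/
inductive ARel : LTerm AGen → LTerm AGen → Prop
  | zero_le_a : ARel (LTerm.zero.inf (.var .a)) LTerm.zero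
  | a_le_a' : ARel (LTerm.inf (.var .a) (.var .a')) (.var .a)
  | a'_le_two_a : ARel (LTerm.inf (.var .a') (LTerm.add (.var .a) (.var .a))) (.var .a')
  | zero_le_b : ARel (LTerm.zero.inf (.var .b)) LTerm.zero
  | zero_le_c : ARel (LTerm.zero.inf (.var .c)) LTerm.zero

/-- The Abelian `ℓ`-group with generators `a, a', b, c` and relations
`0 ≤ a ≤ a' ≤ 2a`, `0 ≤ b`, `0 ≤ c`. -/
abbrev A123 : Type := PresentedLGroup ARel

/-- The image in `A123` of a generator. -/
abbrev A123.gen (x : AGen) : A123 := PresentedLGroup.of x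

/-- The generators of the vertices of the diagram. The cube is the powerset of `Fin 3`, ordered
by inclusion, where the elements `0, 1, 2` of `Fin 3` play the roles of `1, 2, 3`. -/
def vecAGen (p : Finset (Fin 3)) : Set A123 :=
  if p = ∅ then ∅
  else if p = {0} then {A123.gen .a}
  else if p = {1} then {A123.gen .b}
  else if p = {2} then {A123.gen .c}
  else if p = {0, 1} then {A123.gen .a, A123.gen .b}
  else if p = {0, 2} then {A123.gen .a', A123.gen .c}
  else if p = {1, 2} then {A123.gen .b, A123.gen .c}
  else Set.univ

/-- The vertices of the diagram, as `ℓ`-subgroups of `A123`. -/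
abbrev vecA (p : Finset (Fin 3)) : AddSubgroup A123 := lClosure (vecAGen p)

instance instLatticeLClosure {G : Type*} [AddGroup G] [Lattice G] (X : Set G) :
    Lattice (lClosure X) :=
  Subtype.lattice (fun _ _ hx hy => (isLSubgroup_lClosure X _ hx _ hy).1)
    (fun _ _ hx hy => (isLSubgroup_lClosure X _ hx _ hy).2)

/-- The sets of arrows of the diagram. All arrows from `p` to `q` are inclusion maps, except
that the only arrow from `{0}` to `{0, 2}` is the one that sends `a` to `a'`, and that there are
two arrows from `{0}` to `{0, 1, 2}`, the inclusion map and the map that sends `a` to `a'`. -/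
def vecAArrows (p q : Finset (Fin 3)) : Set (LGroupHom (vecA p) (vecA q)) :=
  {f | ¬ (p = {0} ∧ q = {0, 2}) ∧ ∀ x : vecA p, (f x : A123) = x} ∪
  {f | p = {0} ∧ (q = {0, 2} ∨ q = {0, 1, 2}) ∧
    ∀ x : vecA p, (x : A123) = A123.gen .a → (f x : A123) = A123.gen .a'}

/-! ### Real points of `A123` -/

/-! If no `η_i` vanishes, each `G_i` contains some `x_i ≥ 0` whose principal convex `ℓ`-subgroup (or
`ℓ`-ideal) has nonzero image. Replace an ideal of `A_p` by its support, the set of real points of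
`A123` where some element of it is nonzero. Supports are open cones that see only the coordinates
generating `A_p`; the support of a join lies in the union of the supports, and ideals with zero meet
have disjoint supports. Supports need not determine ideals.

Let `D_ij` be the support of the image of `(x_i - x_j)⁺`, computed in `G_ij`. Since `x_i ≤ (x_i -
x_j)⁺ + x_j`, the disjoint open sets `D_12` and `D_21` contain the positive `a`-axis and `b`-axis of
the `(a, b)`-quadrant. By connectedness they both miss some `(α, β)` with `α, β > 0`
(`exists_notMem_supp`).

As `G` commutes, all differences can be compared in `G_123`, where subadditivity gives `D_13 ⊆ D_12
∪ D_23` and `D_23 ⊆ D_21 ∪ D_13`. But `D_13` sees `a'` instead of `a`, and `a'` may be any value in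
`[a, 2a]`. Hence, over `(α, β)`, membership in `D_13` at height `c` propagates to height `2c`, and
so from a neighbourhood of `0` to all `c`. This contradicts `D_31`, which is open, disjoint from
`D_13` and contains the `c`-axis (`false_of_differences`).

`false_of_diagram` extracts these data from the diagram. The two cases differ only in why disjoint
elements generate disjoint subgroups or ideals, which is shown with polars. -/

lemma LGroupHom.map_sup {G H : Type*} [AddGroup G] [Lattice G] [AddGroup H] [Lattice H]
    (f : LGroupHom G H) (x y : G) : f (x ⊔ y) = f x ⊔ f y := f.map_sup' x y

lemma LGroupHom.map_inf {G H : Type*} [AddGroup G] [Lattice G] [AddGroup H] [Lattice H]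
    (f : LGroupHom G H) (x y : G) : f (x ⊓ y) = f x ⊓ f y := f.map_inf' x y

/-- The composition of two `ℓ`-homomorphisms. -/
def LGroupHom.comp {G H K : Type*} [AddGroup G] [Lattice G] [AddGroup H] [Lattice H]
    [AddGroup K] [Lattice K] (g : LGroupHom H K) (f : LGroupHom G H) : LGroupHom G K where
  toAddMonoidHom := g.toAddMonoidHom.comp f.toAddMonoidHom
  map_sup' x y := (congrArg g (f.map_sup x y)).trans (g.map_sup _ _)
  map_inf' x y := (congrArg g (f.map_inf x y)).trans (g.map_inf _ _)

/-- The inclusion map of an `ℓ`-subgroup generated by a set. -/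
def lClosureSubtype {G : Type*} [AddGroup G] [Lattice G] (X : Set G) :
    LGroupHom (lClosure X) G where
  toAddMonoidHom := (lClosure X).subtype
  map_sup' _ _ := rfl
  map_inf' _ _ := rfl

/-- The value of a term under an assignment of real numbers to the variables. -/
def LTerm.eval {X : Type*} (v : X → ℝ) : LTerm X → ℝ
  | var x => v x
  | zero => 0
  | add s t => s.eval v + t.eval v
  | neg s => -s.eval v
  | sup s t => s.eval v ⊔ t.eval v
  | inf s t => s.eval v ⊓ t.eval v

lemma LTerm.continuous_eval {X : Type*} (t : LTerm X) :
    Continuous fun v : X → ℝ => t.eval v := by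
  induction t with
  | var x => exact continuous_apply x
  | zero => exact continuous_const
  | add s t hs ht => exact hs.add ht
  | neg s hs => exact hs.neg
  | sup s t hs ht => exact hs.sup ht
  | inf s t hs ht => exact hs.inf ht

/-- Makes supports cones. Nonnegativity of `r` is what lets the scalar pass through `max` and `min`.
-/
lemma LTerm.eval_smul {X : Type*} {r : ℝ} (hr : 0 ≤ r) (v : X → ℝ) (t : LTerm X) :
    t.eval (r • v) = r * t.eval v := by
  induction t with
  | var x => rfl
  | zero => exact (mul_zero r).symm
  | add s t hs ht => simp only [eval, hs, ht]; ring
  | neg s hs => simp only [eval, hs]; ring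
  | sup s t hs ht => simp only [eval, hs, ht]; exact (mul_max_of_nonneg _ _ hr).symm
  | inf s t hs ht => simp only [eval, hs, ht]; exact (mul_min_of_nonneg _ _ hr).symm

lemma LTerm.Rel.eval_eq {X : Type*} {R : LTerm X → LTerm X → Prop} {v : X → ℝ}
    (hv : ∀ s t, R s t → s.eval v = t.eval v) {s t : LTerm X} (h : LTerm.Rel R s t) :
    s.eval v = t.eval v := by
  induction h with
  | of h => exact hv _ _ h
  | refl s => rfl
  | symm _ h => exact h.symm
  | trans _ _ h h' => exact h.trans h'
  | add_congr _ _ h h' => simp only [eval, h, h']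
  | neg_congr _ h => simp only [eval, h]
  | sup_congr _ _ h h' => simp only [eval, h, h']
  | inf_congr _ _ h h' => simp only [eval, h, h']
  | add_assoc s t u => exact _root_.add_assoc _ _ _
  | add_comm s t => exact _root_.add_comm _ _
  | zero_add s => exact _root_.zero_add _
  | neg_add s => exact neg_add_cancel _
  | sup_comm s t => exact _root_.sup_comm _ _
  | sup_assoc s t u => exact _root_.sup_assoc _ _ _
  | inf_comm s t => exact _root_.inf_comm _ _
  | inf_assoc s t u => exact _root_.inf_assoc _ _ _
  | sup_inf_self s t => exact _root_.sup_inf_self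
  | inf_sup_self s t => exact _root_.inf_sup_self
  | add_sup s t u => exact (max_add_add_left _ _ _).symm

/-- The real assignments that satisfy the relations of `A123`. -/
abbrev APoint : Type :=
  {v : AGen → ℝ // 0 ≤ v .a ∧ v .a ≤ v .a' ∧ v .a' ≤ 2 * v .a ∧ 0 ≤ v .b ∧ 0 ≤ v .c}

namespace APoint

lemma eval_eq_of_rel (P : APoint) (s t : LTerm AGen) (h : ARel s t) :
    s.eval P.1 = t.eval P.1 := by
  obtain ⟨v, h1, h2, h3, h4, h5⟩ := P
  cases h with
  | zero_le_a => exact inf_eq_left.2 h1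
  | a_le_a' => exact inf_eq_left.2 h2
  | a'_le_two_a => exact inf_eq_left.2 (h3.trans_eq (two_mul _))
  | zero_le_b => exact inf_eq_left.2 h4
  | zero_le_c => exact inf_eq_left.2 h5

/-- Evaluation of the elements of `A123` at a point. -/
def ev (P : APoint) : LGroupHom A123 ℝ where
  toFun := Quotient.lift (fun t => t.eval P.1) fun _ _ h => LTerm.Rel.eval_eq P.eval_eq_of_rel h
  map_zero' := rfl
  map_add' := by rintro ⟨s⟩ ⟨t⟩; rfl
  map_sup' := by rintro ⟨s⟩ ⟨t⟩; rfl
  map_inf' := by rintro ⟨s⟩ ⟨t⟩; rfl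

lemma ev_gen (P : APoint) (x : AGen) : P.ev (A123.gen x) = P.1 x := rfl

lemma continuous_ev (w : A123) : Continuous fun P : APoint => P.ev w := by
  obtain ⟨t⟩ := w
  exact t.continuous_eval.comp continuous_subtype_val

lemma ev_smul {r : ℝ} (hr : 0 ≤ r) {P Q : APoint} (h : Q.1 = r • P.1) (w : A123) :
    Q.ev w = r * P.ev w := by
  obtain ⟨t⟩ := w
  change t.eval Q.1 = r * t.eval P.1
  rw [h, LTerm.eval_smul hr]

lemma isLIdeal_ker {G : Type*} [AddGroup G] [Lattice G] (f : LGroupHom G ℝ) :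
    IsLIdeal f.toAddMonoidHom.ker := by
  have := f.isLIdeal_comap (isLIdeal_bot (G := ℝ))
  exact this

/-- Evaluation of the elements of a vertex of the diagram at a point. -/
def evv (P : APoint) (p : Finset (Fin 3)) : LGroupHom (vecA p) ℝ :=
  P.ev.comp (lClosureSubtype _)

lemma evv_apply (P : APoint) (p : Finset (Fin 3)) (w : vecA p) : P.evv p w = P.ev w := rfl

/-- The equalizer of two evaluations is an `ℓ`-subgroup. Hence elements of `A_p` see only the
coordinates of its generators. -/
lemma ev_eq_of_mem_lClosure {P Q : APoint} {X : Set A123} (h : ∀ x ∈ X, P.ev x = Q.ev x)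
    {w : A123} (hw : w ∈ lClosure X) : P.ev w = Q.ev w := by
  let S : AddSubgroup A123 :=
    { carrier := {w | P.ev w = Q.ev w}
      zero_mem' := by simp
      add_mem' := by
        intro x y hx hy
        simp only [Set.mem_ofPred_eq, map_add] at *
        rw [hx, hy]
      neg_mem' := by
        intro x hx
        simp only [Set.mem_ofPred_eq, map_neg] at *
        rw [hx] }
  have hS : IsLSubgroup S := by
    intro x hx y hy
    change P.ev x = Q.ev x at hx
    change P.ev y = Q.ev y at hy
    constructor
    · change P.ev (x ⊔ y) = Q.ev (x ⊔ y)
      rw [LGroupHom.map_sup, LGroupHom.map_sup, hx, hy]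
    · change P.ev (x ⊓ y) = Q.ev (x ⊓ y)
      rw [LGroupHom.map_inf, LGroupHom.map_inf, hx, hy]
  exact lClosure_le hS h hw

end APoint

/-! ### The support of an ideal -/

/-- The set of points at which some element of a given ideal does not vanish. -/
def Idc.supp {p : Finset (Fin 3)} (I : Idc (vecA p)) : Set APoint :=
  {P | ∃ w ∈ I.1, P.evv p w ≠ 0}

namespace Idc

variable {p q : Finset (Fin 3)}

/-- Kernels of evaluations are `ℓ`-ideals, so this form allows non-membership to be tested on
generators. -/
lemma notMem_supp {I : Idc (vecA p)} {P : APoint} :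
    P ∉ I.supp ↔ I.1 ≤ (P.evv p).toAddMonoidHom.ker := by
  simp only [supp, Set.mem_ofPred_eq, not_exists, not_and, not_not]
  rfl

lemma isOpen_supp (I : Idc (vecA p)) : IsOpen I.supp := by
  have : I.supp = ⋃ w ∈ I.1, {P : APoint | P.ev w ≠ 0} := by
    ext P
    simp [supp, APoint.evv_apply]
  rw [this]
  exact isOpen_biUnion fun w _ => isOpen_ne_fun (APoint.continuous_ev _) continuous_const

lemma mem_supp_of_smul {r : ℝ} (hr : 0 < r) {P Q : APoint} (h : Q.1 = r • P.1)
    {I : Idc (vecA p)} (hP : P ∈ I.supp) : Q ∈ I.supp := by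
  obtain ⟨w, hw, hw'⟩ := hP
  refine ⟨w, hw, ?_⟩
  rw [APoint.evv_apply, APoint.ev_smul hr.le h]
  exact mul_ne_zero hr.ne' hw'

lemma mem_supp_of_eqOn {P Q : APoint} (h : ∀ x ∈ vecAGen p, P.ev x = Q.ev x)
    {I : Idc (vecA p)} (hP : P ∈ I.supp) : Q ∈ I.supp := by
  obtain ⟨w, hw, hw'⟩ := hP
  refine ⟨w, hw, ?_⟩
  rwa [APoint.evv_apply, ← APoint.ev_eq_of_mem_lClosure h w.2]

lemma supp_mono {I J : Idc (vecA p)} (h : I ≤ J) : I.supp ⊆ J.supp := by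
  rintro P ⟨w, hw, hw'⟩
  exact ⟨w, h hw, hw'⟩

lemma supp_of_isLUB {I J K : Idc (vecA p)} (h : IsLUB {I, J} K) :
    K.supp ⊆ I.supp ∪ J.supp := by
  intro P hP
  by_contra hn
  rw [Set.mem_union, not_or, notMem_supp, notMem_supp] at hn
  obtain ⟨X, hX, hIX⟩ := I.2
  obtain ⟨Y, hY, hJY⟩ := J.2
  -- The join is given only by its universal property, so it is bounded by an explicit finitely
  -- generated ideal.
  let L : Idc (vecA p) := ⟨lIdealClosure (X ∪ Y), X ∪ Y, hX.union hY, rfl⟩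
  have hKL : K ≤ L := by
    apply h.2
    rintro M (rfl | rfl)
    · change M.1 ≤ _
      rw [hIX]
      exact lIdealClosure_le (isLIdeal_lIdealClosure _)
        (Set.subset_union_left.trans (subset_lIdealClosure _))
    · change M.1 ≤ _
      rw [hJY]
      exact lIdealClosure_le (isLIdeal_lIdealClosure _)
        (Set.subset_union_right.trans (subset_lIdealClosure _))
  refine notMem_supp.2 (le_trans hKL ?_) hP
  refine lIdealClosure_le (APoint.isLIdeal_ker _) (Set.union_subset ?_ ?_)
  · exact (subset_lIdealClosure X).trans (hIX ▸ hn.1)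
  · exact (subset_lIdealClosure Y).trans (hJY ▸ hn.2)

lemma isLIdeal {G : Type*} [AddGroup G] [Lattice G] (I : Idc G) : IsLIdeal I.1 := by
  obtain ⟨X, _, h⟩ := I.2
  rw [h]
  exact isLIdeal_lIdealClosure X

/-- If `w ∈ I` and `x ∈ J` are nonzero at `P`, then `|w| ⊓ |x|` lies in both ideals and is positive
at `P`, so the meet cannot be zero. -/
lemma supp_disjoint_of_isGLB {I J : Idc (vecA p)} (h : IsGLB {I, J} ⊥) {P : APoint}
    (hI : P ∈ I.supp) (hJ : P ∈ J.supp) : False := by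
  obtain ⟨w, hw, hw'⟩ := hI
  obtain ⟨x, hx, hx'⟩ := hJ
  have habs : ∀ (K : Idc (vecA p)) (y : vecA p), y ∈ K.1 → y ⊔ -y ∈ K.1 := fun K y hy =>
    (K.isLIdeal.1.1 y hy _ (neg_mem hy)).1
  have hnonneg : ∀ y : vecA p, 0 ≤ y ⊔ -y := fun y => by
    have : (0 : A123) ≤ |(y : A123)| := abs_nonneg _
    exact this
  have hev : ∀ y : vecA p, P.evv p (y ⊔ -y) = |P.evv p y| := fun y => by
    rw [LGroupHom.map_sup, map_neg]
    rfl
  let z := (w ⊔ -w) ⊓ (x ⊔ -x)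
  have hz : 0 ≤ z := le_inf (hnonneg w) (hnonneg x)
  let L : Idc (vecA p) := ⟨lIdealClosure {z}, {z}, Set.finite_singleton z, rfl⟩
  have hL : L ≤ ⊥ := by
    apply h.2
    rintro M (rfl | rfl)
    · exact lIdealClosure_le M.isLIdeal (Set.singleton_subset_iff.2
        (M.isLIdeal.1.2.out (zero_mem _) (habs _ _ hw) ⟨hz, inf_le_left⟩))
    · exact lIdealClosure_le M.isLIdeal (Set.singleton_subset_iff.2
        (M.isLIdeal.1.2.out (zero_mem _) (habs _ _ hx) ⟨hz, inf_le_right⟩))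
  have hz0 : z = 0 :=
    (AddSubgroup.mem_bot (G := vecA p)).1 (hL (subset_lIdealClosure _ (Set.mem_singleton z)))
  have : P.evv p z = |P.evv p w| ⊓ |P.evv p x| := by
    rw [LGroupHom.map_inf, hev, hev]
  rw [hz0, map_zero] at this
  exact absurd this (lt_min (abs_pos.2 hw') (abs_pos.2 hx')).ne

lemma supp_map {f : LGroupHom (vecA p) (vecA q)} {P Q : APoint}
    (h : ∀ x, Q.evv q (f x) = P.evv p x) (I : Idc (vecA p)) :
    Q ∈ (Idc.map f I).supp ↔ P ∈ I.supp := by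
  rw [← not_iff_not, notMem_supp, notMem_supp]
  constructor
  · intro hI x hx
    have : f x ∈ (Q.evv q).toAddMonoidHom.ker :=
      hI (subset_lIdealClosure _ (Set.mem_image_of_mem _ hx))
    exact (h x).symm.trans this
  · intro hI
    refine lIdealClosure_le (APoint.isLIdeal_ker _) ?_
    rintro _ ⟨x, hx, rfl⟩
    exact (h x).trans (hI hx)

end Idc

/-! ### Vertices with a single generator -/

/-- The multiples of a positive element form a chain, so they are already a sublattice. -/
lemma lClosure_singleton_le_zmultiples {G : Type*} [AddCommGroup G] [Lattice G]
    [IsOrderedAddMonoid G] {g : G} (hg : 0 ≤ g) :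
    lClosure {g} ≤ AddSubgroup.zmultiples g := by
  refine lClosure_le ?_ (Set.singleton_subset_iff.2 (AddSubgroup.mem_zmultiples g))
  rintro _ ⟨m, rfl⟩ _ ⟨n, rfl⟩
  rcases le_total m n with h | h
  · have := zsmul_le_zsmul_left hg h
    exact ⟨⟨n, (sup_eq_right.2 this).symm⟩, ⟨m, (inf_eq_left.2 this).symm⟩⟩
  · have := zsmul_le_zsmul_left hg h
    exact ⟨⟨m, (sup_eq_left.2 this).symm⟩, ⟨n, (inf_eq_right.2 this).symm⟩⟩

lemma A123.gen_nonneg (x : AGen) : 0 ≤ A123.gen x := by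
  have ha : (0 : A123) ≤ A123.gen .a := inf_eq_left.1 (Quotient.sound (.of .zero_le_a))
  cases x with
  | a => exact ha
  | a' => exact ha.trans (inf_eq_left.1 (Quotient.sound (.of .a_le_a')))
  | b => exact inf_eq_left.1 (Quotient.sound (.of .zero_le_b))
  | c => exact inf_eq_left.1 (Quotient.sound (.of .zero_le_c))

/-- All elements of the vertex are integer multiples of the generator, so a nonzero ideal contains
some `n • x` with `n ≠ 0`. This is the only place where a nonzero ideal is shown to have points in
its support. -/
lemma Idc.mem_supp_of_singleton {p : Finset (Fin 3)} {x : AGen} (hp : vecAGen p = {A123.gen x})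
    {I : Idc (vecA p)} (hI : I ≠ ⊥) {P : APoint} : P ∈ I.supp ↔ P.1 x ≠ 0 := by
  have key : ∀ w : vecA p, ∃ n : ℤ, (w : A123) = n • A123.gen x := fun w => by
    have hw : (w : A123) ∈ lClosure {A123.gen x} := hp ▸ w.2
    obtain ⟨n, hn⟩ := lClosure_singleton_le_zmultiples (A123.gen_nonneg x) hw
    exact ⟨n, hn.symm⟩
  constructor
  · rintro ⟨w, hw, hw'⟩ h
    obtain ⟨n, hn⟩ := key w
    apply hw'
    rw [APoint.evv_apply, hn, map_zsmul, APoint.ev_gen, h, smul_zero]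
  · intro h
    obtain ⟨w, hw, hw0⟩ : ∃ w ∈ I.1, w ≠ 0 := by
      by_contra! hn
      exact hI (le_bot_iff.1 fun w hw => (AddSubgroup.mem_bot (G := vecA p)).2 (hn w hw))
    obtain ⟨n, hn⟩ := key w
    refine ⟨w, hw, ?_⟩
    rw [APoint.evv_apply, hn, map_zsmul, APoint.ev_gen, zsmul_eq_mul]
    refine mul_ne_zero (Int.cast_ne_zero.2 ?_) h
    rintro rfl
    exact hw0 (Subtype.ext (by simpa using hn))

/-! ### The obstruction -/

namespace APoint

/-- The point with given coordinates. -/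
def ofCoords (a a' b c : ℝ) (h : 0 ≤ a ∧ a ≤ a' ∧ a' ≤ 2 * a ∧ 0 ≤ b ∧ 0 ≤ c) : APoint :=
  ⟨fun | .a => a | .a' => a' | .b => b | .c => c, h⟩

lemma continuous_ofCoords {T : Type*} [TopologicalSpace T] {a a' b c : T → ℝ}
    (ha : Continuous a) (ha' : Continuous a') (hb : Continuous b) (hc : Continuous c)
    (h : ∀ t, 0 ≤ a t ∧ a t ≤ a' t ∧ a' t ≤ 2 * a t ∧ 0 ≤ b t ∧ 0 ≤ c t) :
    Continuous fun t => ofCoords (a t) (a' t) (b t) (c t) (h t) := by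
  refine Continuous.subtype_mk (continuous_pi fun x => ?_) _
  cases x <;> assumption

end APoint

lemma vecAGen_zero : vecAGen {0} = {A123.gen .a} := by simp [vecAGen]

lemma vecAGen_one : vecAGen {1} = {A123.gen .b} := by simp [vecAGen]

lemma vecAGen_two : vecAGen {2} = {A123.gen .c} := by simp [vecAGen]

lemma vecAGen_zero_one : vecAGen {0, 1} = {A123.gen .a, A123.gen .b} := by
  simp [vecAGen, show ({0, 1} : Finset (Fin 3)) ≠ {0} by decide,
    show ({0, 1} : Finset (Fin 3)) ≠ {1} by decide, show ({0, 1} : Finset (Fin 3)) ≠ {2} by decide]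

lemma vecAGen_zero_two : vecAGen {0, 2} = {A123.gen .a', A123.gen .c} := by
  simp [vecAGen, show ({0, 2} : Finset (Fin 3)) ≠ {0} by decide,
    show ({0, 2} : Finset (Fin 3)) ≠ {1} by decide, show ({0, 2} : Finset (Fin 3)) ≠ {2} by decide,
    show ({0, 2} : Finset (Fin 3)) ≠ {0, 1} by decide]

lemma vecAGen_one_two : vecAGen {1, 2} = {A123.gen .b, A123.gen .c} := by
  simp [vecAGen, show ({1, 2} : Finset (Fin 3)) ≠ {0} by decide,
    show ({1, 2} : Finset (Fin 3)) ≠ {1} by decide, show ({1, 2} : Finset (Fin 3)) ≠ {2} by decide,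
    show ({1, 2} : Finset (Fin 3)) ≠ {0, 1} by decide,
    show ({1, 2} : Finset (Fin 3)) ≠ {0, 2} by decide]

/-- Ideals of `A₁₂` with disjoint supports that separate the two axes leave out a point with
positive coordinates. -/
lemma exists_notMem_supp {I J : Idc (vecA {0, 1})}
    (hI : ∀ P : APoint, P.1 .a ≠ 0 → P ∈ I.supp ∨ P.1 .b ≠ 0)
    (hJ : ∀ P : APoint, P.1 .b ≠ 0 → P ∈ J.supp ∨ P.1 .a ≠ 0)
    (hIJ : ∀ P : APoint, P ∈ I.supp → P ∈ J.supp → False) :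
    ∃ α β : ℝ, 0 < α ∧ 0 < β ∧
      ∀ P : APoint, P.1 .a = α → P.1 .b = β → P ∉ I.supp ∧ P ∉ J.supp := by
  -- A segment joining the two axes. The values of `a'` and `c` are arbitrary admissible ones,
  -- invisible to ideals of `A₁₂`.
  let f : unitInterval → APoint := fun t =>
    .ofCoords (1 - t) (1 - t) t 0
      ⟨sub_nonneg.2 t.2.2, le_rfl, by linarith [t.2.2], t.2.1, le_rfl⟩
  have hf : Continuous f := by
    apply APoint.continuous_ofCoords <;> fun_prop
  have h0 : f 0 ∈ I.supp := by
    refine (hI (f 0) ?_).resolve_right ?_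
    · change (1 - (0 : ℝ)) ≠ 0
      norm_num
    · exact not_not.2 rfl
  have h1 : f 1 ∈ J.supp := by
    refine (hJ (f 1) ?_).resolve_right ?_
    · exact one_ne_zero (α := ℝ)
    · exact not_not.2 (sub_self (1 : ℝ))
  -- Otherwise two disjoint nonempty open sets would cover the segment.
  obtain ⟨t, ht⟩ : ∃ t, f t ∉ I.supp ∧ f t ∉ J.supp := by
    by_contra! hn
    obtain ⟨t, -, htI, htJ⟩ := isPreconnected_univ (α := unitInterval) _ _
      (I.isOpen_supp.preimage hf) (J.isOpen_supp.preimage hf)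
      (fun t _ => or_iff_not_imp_left.2 (hn t)) ⟨0, trivial, h0⟩ ⟨1, trivial, h1⟩
    exact hIJ _ htI htJ
  refine ⟨1 - t, t, ?_, ?_, fun P hPa hPb => ?_⟩
  · refine lt_of_le_of_ne (sub_nonneg.2 t.2.2) fun h => ht.2 ?_
    have : t = 1 := Subtype.ext (by simpa using (sub_eq_zero.1 h.symm).symm)
    rwa [this]
  · refine lt_of_le_of_ne t.2.1 fun h => ht.1 ?_
    have : t = 0 := Subtype.ext h.symm
    rwa [this]
  · have key : ∀ x ∈ vecAGen {0, 1}, P.ev x = (f t).ev x := by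
      rw [vecAGen_zero_one]
      rintro x (rfl | rfl)
      · exact hPa
      · exact hPb
    exact ⟨fun h => ht.1 (Idc.mem_supp_of_eqOn key h), fun h => ht.2 (Idc.mem_supp_of_eqOn key h)⟩

/-- There are no ideals that behave like the differences of three elements along the diagram. -/
lemma false_of_differences {I₁₂ I₂₁ : Idc (vecA {0, 1})} {I₁₃ I₃₁ : Idc (vecA {0, 2})}
    {I₂₃ : Idc (vecA {1, 2})}
    (h₁₂ : ∀ P : APoint, P.1 .a ≠ 0 → P ∈ I₁₂.supp ∨ P.1 .b ≠ 0)
    (h₂₁ : ∀ P : APoint, P.1 .b ≠ 0 → P ∈ I₂₁.supp ∨ P.1 .a ≠ 0)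
    (h₁₃ : ∀ P : APoint, P.1 .a' ≠ 0 → P ∈ I₁₃.supp ∨ P.1 .c ≠ 0)
    (h₃₁ : ∀ P : APoint, P.1 .c ≠ 0 → P ∈ I₃₁.supp ∨ P.1 .a' ≠ 0)
    (d₁₂ : ∀ P : APoint, P ∈ I₁₂.supp → P ∈ I₂₁.supp → False)
    (d₁₃ : ∀ P : APoint, P ∈ I₁₃.supp → P ∈ I₃₁.supp → False)
    (t₁₃ : ∀ P : APoint, P ∈ I₁₃.supp → P ∈ I₁₂.supp ∨ P ∈ I₂₃.supp)
    (t₂₃ : ∀ P : APoint, P ∈ I₂₃.supp → P ∈ I₂₁.supp ∨ P ∈ I₁₃.supp) : False := by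
  obtain ⟨α, β, hα, hβ, hαβ⟩ := exists_notMem_supp h₁₂ h₂₁ d₁₂
  -- The absolute value defines the point for every real `c`, so that openness can be used on both
  -- sides of `0`.
  let Q : ℝ → APoint := fun c => .ofCoords α α β |c|
    ⟨hα.le, le_rfl, by linarith, hβ.le, abs_nonneg c⟩
  have hQ : Continuous Q := by
    apply APoint.continuous_ofCoords <;> fun_prop
  have double : ∀ c, Q c ∈ I₁₃.supp → Q (2 * c) ∈ I₁₃.supp := by
    intro c hc
    have h2 : 0 ≤ |2 * c| := abs_nonneg _
    -- `S` is `Q c` scaled by 2. `R` agrees with `S` on `a', c`, with `Q (2 * c)` on `b, c`, and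
    -- still lies over `(α, β)`; it exists because `a' = 2 * a` is allowed.
    let R : APoint := .ofCoords α (2 * α) β |2 * c|
      ⟨hα.le, by linarith, le_rfl, hβ.le, h2⟩
    let S : APoint := .ofCoords (2 * α) (2 * α) (2 * β) |2 * c|
      ⟨by linarith, le_rfl, by linarith, by linarith, h2⟩
    have hS : S ∈ I₁₃.supp := by
      refine Idc.mem_supp_of_smul (r := 2) two_pos ?_ hc
      funext x
      cases x with
      | c => exact (abs_mul 2 c).trans (by rw [abs_two]; rfl)
      | _ => rfl
    have hR : R ∈ I₁₃.supp := by
      refine Idc.mem_supp_of_eqOn ?_ hS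
      rw [vecAGen_zero_two]
      rintro x (rfl | rfl) <;> rfl
    have hR' : R ∈ I₂₃.supp := (t₁₃ R hR).resolve_left (hαβ R rfl rfl).1
    have hQ' : Q (2 * c) ∈ I₂₃.supp := by
      refine Idc.mem_supp_of_eqOn ?_ hR'
      rw [vecAGen_one_two]
      rintro x (rfl | rfl) <;> rfl
    exact (t₂₃ _ hQ').resolve_left (hαβ _ rfl rfl).2
  have double_pow : ∀ (n : ℕ) (c : ℝ), Q c ∈ I₁₃.supp → Q (2 ^ n * c) ∈ I₁₃.supp := by
    intro n
    induction n with
    | zero => intro c hc; simpa using hc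
    | succ n ih => intro c hc; rw [pow_succ', mul_assoc]; exact double _ (ih c hc)
  have hQ0 : Q 0 ∈ I₁₃.supp := by
    refine (h₁₃ (Q 0) hα.ne').resolve_right (not_not.2 ?_)
    exact abs_zero
  have hall : ∀ c, Q c ∈ I₁₃.supp := by
    intro c
    have hlim : Filter.Tendsto (fun n : ℕ => c / 2 ^ n) Filter.atTop (nhds 0) :=
      tendsto_const_nhds.div_atTop (tendsto_pow_atTop_atTop_of_one_lt one_lt_two)
    obtain ⟨n, hn⟩ := (hlim.eventually
      ((I₁₃.isOpen_supp.preimage hQ).mem_nhds hQ0)).exists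
    have := double_pow n _ hn
    rwa [mul_div_cancel₀ c (by positivity)] at this
  -- The point `Q (1 / s)` scaled by `s > 0`: as `s` tends to `0` it approaches the `c`-axis, where
  -- `I₃₁` is supported.
  let R : ℝ → APoint := fun s => .ofCoords (|s| * α) (|s| * α) (|s| * β) 1
    ⟨by positivity, le_rfl, by linarith [mul_nonneg (abs_nonneg s) hα.le], by positivity, one_pos.le⟩
  have hR : Continuous R := by
    apply APoint.continuous_ofCoords <;> fun_prop
  have hR0 : R 0 ∈ I₃₁.supp := by
    refine (h₃₁ (R 0) (one_ne_zero (α := ℝ))).resolve_right (not_not.2 ?_)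
    change |(0 : ℝ)| * α = 0
    simp
  have hlim : Filter.Tendsto (fun n : ℕ => 1 / ((n : ℝ) + 1)) Filter.atTop (nhds 0) :=
    tendsto_one_div_add_atTop_nhds_zero_nat
  obtain ⟨n, hn⟩ := (hlim.eventually ((I₃₁.isOpen_supp.preimage hR).mem_nhds hR0)).exists
  have hpos : (0 : ℝ) < n + 1 := by positivity
  have habs : |1 / ((n : ℝ) + 1)| = 1 / ((n : ℝ) + 1) := abs_of_pos (by positivity)
  refine d₁₃ _ (hall (n + 1)) (Idc.mem_supp_of_smul (r := n + 1) hpos ?_ hn)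
  have hmul : ∀ y : ℝ, y = ((n : ℝ) + 1) * (|1 / ((n : ℝ) + 1)| * y) := fun y => by
    rw [habs]
    field_simp
  funext x
  cases x with
  | a => exact hmul α
  | a' => exact hmul α
  | b => exact hmul β
  | c => exact (abs_of_pos hpos).trans (mul_one _).symm

/-! ### Arrows of the diagram -/

/-- The inclusion map between the `ℓ`-subgroups generated by two sets. -/
def lClosureInclusion {G : Type*} [AddGroup G] [Lattice G] {X Y : Set G}
    (h : lClosure X ≤ lClosure Y) : LGroupHom (lClosure X) (lClosure Y) where
  toAddMonoidHom := AddSubgroup.inclusion h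
  map_sup' _ _ := rfl
  map_inf' _ _ := rfl

lemma lClosure_mono {G : Type*} [AddGroup G] [Lattice G] {X Y : Set G} (h : X ⊆ Y) :
    lClosure X ≤ lClosure Y :=
  lClosure_le (isLSubgroup_lClosure Y) (h.trans (subset_lClosure Y))

lemma exists_inclusion_mem_vecAArrows {p q : Finset (Fin 3)} (h : vecAGen p ⊆ vecAGen q)
    (hpq : ¬(p = {0} ∧ q = {0, 2})) :
    ∃ f ∈ vecAArrows p q, ∀ x : vecA p, (f x : A123) = x :=
  ⟨lClosureInclusion (lClosure_mono h), Or.inl ⟨hpq, fun _ => rfl⟩, fun _ => rfl⟩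

/-- In an Abelian `ℓ`-group, there is an `ℓ`-homomorphism sending a positive element of
infinite order to any positive element. -/
lemma exists_lGroupHom_lClosure_singleton {G H : Type*} [AddCommGroup G] [Lattice G]
    [IsOrderedAddMonoid G] [AddCommGroup H] [Lattice H] [IsOrderedAddMonoid H] {X : Set G} {g : G}
    (hX : X = {g}) (hg : 0 ≤ g) (hg' : ∀ n : ℤ, n • g = 0 → n = 0) {h : H} (hh : 0 ≤ h) :
    ∃ f : LGroupHom (lClosure X) H, ∀ (x : lClosure X) (n : ℤ), (x : G) = n • g → f x = n • h := by
  subst hX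
  have key : ∀ w : lClosure {g}, ∃ n : ℤ, (w : G) = n • g := fun w => by
    obtain ⟨n, hn⟩ := lClosure_singleton_le_zmultiples hg w.2
    exact ⟨n, hn.symm⟩
  choose k hk using key
  have uniq : ∀ (w : lClosure {g}) (n : ℤ), (w : G) = n • g → k w = n := fun w n hn =>
    sub_eq_zero.1 (hg' _ (by rw [sub_smul, ← hk, hn, sub_self]))
  have mono : ∀ m n : ℤ, m ≤ n → m • g ≤ n • g := fun _ _ => zsmul_le_zsmul_left hg
  have mono' : ∀ m n : ℤ, m ≤ n → m • h ≤ n • h := fun _ _ => zsmul_le_zsmul_left hh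
  have ksup : ∀ x y, k (x ⊔ y) = k x ⊔ k y := fun x y => uniq _ _ (by
    change (x : G) ⊔ (y : G) = _
    rw [hk x, hk y]
    exact ((show Monotone fun n : ℤ => n • g from fun m n => mono m n).map_sup _ _).symm)
  have kinf : ∀ x y, k (x ⊓ y) = k x ⊓ k y := fun x y => uniq _ _ (by
    change (x : G) ⊓ (y : G) = _
    rw [hk x, hk y]
    exact ((show Monotone fun n : ℤ => n • g from fun m n => mono m n).map_inf _ _).symm)
  refine ⟨{ toFun := fun x => k x • h, map_zero' := ?_, map_add' := fun x y => ?_,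
            map_sup' := fun x y => ?_, map_inf' := fun x y => ?_ }, fun x n hn => ?_⟩
  · rw [uniq 0 0 (by simp), zero_smul]
  · rw [uniq (x + y) (k x + k y) (by rw [add_smul, ← hk, ← hk]; rfl), add_smul]
  · rw [ksup]
    exact (show Monotone fun n : ℤ => n • h from fun m n => mono' m n).map_sup _ _
  · rw [kinf]
    exact (show Monotone fun n : ℤ => n • h from fun m n => mono' m n).map_inf _ _
  · change k x • h = n • h
    rw [uniq x n hn]

instance {X : Set A123} : IsOrderedAddMonoid (lClosure X) where
  add_le_add_left x y h z := by
    have : (x : A123) + z ≤ y + z := add_le_add_left (show (x : A123) ≤ y from h) _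
    exact this

lemma exists_twist_mem_vecAArrows :
    ∃ f ∈ vecAArrows {0} {0, 2}, ∀ (x : vecA {0}) (n : ℤ), (x : A123) = n • A123.gen .a →
      (f x : A123) = n • A123.gen .a' := by
  have hmem : A123.gen .a' ∈ vecA {0, 2} :=
    subset_lClosure _ (by rw [vecAGen_zero_two]; exact Or.inl rfl)
  -- Infinite order of `a` is detected at a point where `a = 1`.
  have hinf : ∀ n : ℤ, n • A123.gen .a = 0 → n = 0 := fun n hn => by
    have h := congrArg (APoint.ofCoords 1 1 0 0 (by norm_num)).ev hn
    rw [map_zsmul, APoint.ev_gen, map_zero] at h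
    change n • (1 : ℝ) = 0 at h
    simpa using h
  obtain ⟨f, hf⟩ := exists_lGroupHom_lClosure_singleton (H := vecA {0, 2}) vecAGen_zero
    (A123.gen_nonneg .a) hinf (h := ⟨A123.gen .a', hmem⟩) (A123.gen_nonneg .a')
  have hf' : ∀ (x : vecA {0}) (n : ℤ), (x : A123) = n • A123.gen .a →
      (f x : A123) = n • A123.gen .a' := fun x n hx => by
    rw [hf x n hx]
    rfl
  refine ⟨f, Or.inr ⟨rfl, Or.inl rfl, fun x hx => ?_⟩, hf'⟩
  rw [hf' x 1 (by rw [hx, one_smul]), one_smul]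

lemma Idc.supp_map_inclusion {p q : Finset (Fin 3)} {f : LGroupHom (vecA p) (vecA q)}
    (hf : ∀ x : vecA p, (f x : A123) = x) (I : Idc (vecA p)) : (Idc.map f I).supp = I.supp := by
  ext P
  exact supp_map (fun x => by rw [APoint.evv_apply, APoint.evv_apply, hf]) I

lemma Idc.mem_supp_map_twist {f : LGroupHom (vecA {0}) (vecA {0, 2})}
    (hf : ∀ (x : vecA {0}) (n : ℤ), (x : A123) = n • A123.gen .a →
      (f x : A123) = n • A123.gen .a') {I : Idc (vecA {0})} (hI : I ≠ ⊥) {P : APoint} :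
    P ∈ (Idc.map f I).supp ↔ P.1 .a' ≠ 0 := by
  have ha' : 0 ≤ P.1 .a' := P.2.1.trans P.2.2.1
  -- On `A₁`, the twist followed by evaluation at `P` is evaluation at a point whose `a`-coordinate
  -- is the `a'`-coordinate of `P`.
  let Q : APoint := .ofCoords (P.1 .a') (P.1 .a') 0 0
    ⟨ha', le_rfl, by linarith, le_rfl, le_rfl⟩
  refine (supp_map (P := Q) (fun x => ?_) I).trans (mem_supp_of_singleton vecAGen_zero hI)
  have hx : (x : A123) ∈ lClosure {A123.gen .a} := vecAGen_zero ▸ x.2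
  obtain ⟨n, hn⟩ := lClosure_singleton_le_zmultiples (A123.gen_nonneg .a) hx
  rw [APoint.evv_apply, APoint.evv_apply, hf x n hn.symm, ← show n • A123.gen .a = x from hn,
    map_zsmul, map_zsmul]
  rfl

/-! ### Positive parts of differences -/

section Differences

variable {G : Type*} [AddGroup G] [Lattice G]

lemma LGroupHom.map_posPart {H : Type*} [AddGroup H] [Lattice H] (f : LGroupHom G H) (x : G) :
    f x⁺ = (f x)⁺ := by
  rw [posPart_def, posPart_def, f.map_sup, map_zero]

variable [AddRightMono G]

lemma le_posPart_sub_add (x y : G) : x ≤ (x - y)⁺ + y :=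
  (sub_add_cancel x y).symm.le.trans (add_le_add_left (le_posPart _) y)

variable [AddLeftMono G]

lemma posPart_sub_le (x y z : G) : (x - z)⁺ ≤ (x - y)⁺ + (y - z)⁺ := by
  refine sup_le ?_ (add_nonneg (posPart_nonneg _) (posPart_nonneg _))
  rw [← sub_add_sub_cancel x y z]
  exact add_le_add (le_posPart _) (le_posPart _)

lemma posPart_sub_inf_posPart_sub (x y : G) : (x - y)⁺ ⊓ (y - x)⁺ = 0 := by
  rw [← neg_sub x y, posPart_neg, posPart_inf_negPart_eq_zero]

end Differences

/-- The common core of the two cases: `V p x` stands for the image of the ideal generated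
by `x`. -/
lemma false_of_diagram {G : Finset (Fin 3) → Type*} [∀ p, AddGroup (G p)] [∀ p, Lattice (G p)]
    [∀ p, AddLeftMono (G p)] [∀ p, AddRightMono (G p)]
    (γ : ∀ p q : Finset (Fin 3), p ≤ q → LGroupHom (G p) (G q))
    (γ_comp : ∀ (p q r : Finset (Fin 3)) (hpq : p ≤ q) (hqr : q ≤ r) (x : G p),
      γ p r (hpq.trans hqr) x = γ q r hqr (γ p q hpq x))
    (V : ∀ p, G p → Idc (vecA p))
    (V_add : ∀ p (x y z : G p), 0 ≤ x → 0 ≤ y → 0 ≤ z → x ≤ y + z →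
      (V p x).supp ⊆ (V p y).supp ∪ (V p z).supp)
    (V_disj : ∀ p (x y : G p), x ⊓ y = 0 → ∀ P, P ∈ (V p x).supp → P ∈ (V p y).supp → False)
    (V_nat : ∀ (p q : Finset (Fin 3)) (hpq : p ≤ q), ∀ f ∈ vecAArrows p q, ∀ x : G p,
      V q (γ p q hpq x) = Idc.map f (V p x))
    (hV : ∀ i : Fin 3, ∃ x : G {i}, 0 ≤ x ∧ V {i} x ≠ ⊥) : False := by
  obtain ⟨x₁, hx₁, hV₁⟩ := hV 0
  obtain ⟨x₂, hx₂, hV₂⟩ := hV 1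
  obtain ⟨x₃, hx₃, hV₃⟩ := hV 2
  have map_nonneg : ∀ {p q} (h : p ≤ q) {x : G p}, 0 ≤ x → 0 ≤ γ p q h x := fun h x hx => by
    simpa using (γ _ _ h).mono hx
  have l1_12 : ({0} : Finset (Fin 3)) ≤ {0, 1} := by decide
  have l2_12 : ({1} : Finset (Fin 3)) ≤ {0, 1} := by decide
  have l1_13 : ({0} : Finset (Fin 3)) ≤ {0, 2} := by decide
  have l3_13 : ({2} : Finset (Fin 3)) ≤ {0, 2} := by decide
  have l2_23 : ({1} : Finset (Fin 3)) ≤ {1, 2} := by decide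
  have l3_23 : ({2} : Finset (Fin 3)) ≤ {1, 2} := by decide
  have supp_incl : ∀ {p q} (h : p ≤ q), vecAGen p ⊆ vecAGen q → ¬(p = {0} ∧ q = {0, 2}) →
      ∀ x : G p, (V q (γ p q h x)).supp = (V p x).supp := fun h hg hn x => by
    obtain ⟨f, hf, hf'⟩ := exists_inclusion_mem_vecAArrows hg hn
    rw [V_nat _ _ h f hf, Idc.supp_map_inclusion hf']
  have s1_12 : ∀ P, P ∈ (V _ (γ _ _ l1_12 x₁)).supp ↔ P.1 .a ≠ 0 := fun P => by
    rw [supp_incl _ (by rw [vecAGen_zero, vecAGen_zero_one]; simp) (by decide)]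
    exact Idc.mem_supp_of_singleton vecAGen_zero hV₁
  have s2_12 : ∀ P, P ∈ (V _ (γ _ _ l2_12 x₂)).supp ↔ P.1 .b ≠ 0 := fun P => by
    rw [supp_incl _ (by rw [vecAGen_one, vecAGen_zero_one]; simp) (by decide)]
    exact Idc.mem_supp_of_singleton vecAGen_one hV₂
  have s3_13 : ∀ P, P ∈ (V _ (γ _ _ l3_13 x₃)).supp ↔ P.1 .c ≠ 0 := fun P => by
    rw [supp_incl _ (by rw [vecAGen_two, vecAGen_zero_two]; simp) (by decide)]
    exact Idc.mem_supp_of_singleton vecAGen_two hV₃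
  -- The twisted arrow enters here: the image of `x₁` in the vertex `{0, 2}` is seen through `a'`,
  -- not `a`.
  have s1_13 : ∀ P, P ∈ (V _ (γ _ _ l1_13 x₁)).supp ↔ P.1 .a' ≠ 0 := fun P => by
    obtain ⟨f, hf, hf'⟩ := exists_twist_mem_vecAArrows
    rw [V_nat _ _ l1_13 f hf]
    exact Idc.mem_supp_map_twist hf' hV₁
  have diff : ∀ p (x y : G p), 0 ≤ x → 0 ≤ y → ∀ P, P ∈ (V p x).supp →
      P ∈ (V p (x - y)⁺).supp ∨ P ∈ (V p y).supp := fun p x y hx hy P hP =>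
    V_add p _ _ _ hx (posPart_nonneg _) hy (le_posPart_sub_add x y) hP
  have top_gen : vecAGen {0, 1, 2} = Set.univ := by
    have h : ∀ q : Finset (Fin 3), q.card ≤ 2 → ({0, 1, 2} : Finset (Fin 3)) ≠ q := by decide
    simp [vecAGen, h {0} (by decide), h {1} (by decide), h {2} (by decide),
      h {0, 1} (by decide), h {0, 2} (by decide), h {1, 2} (by decide)]
  -- Inclusions preserve supports, so each difference may be moved to the top vertex; there
  -- commutativity of `γ` gives each `x_i` a single image, whichever route is taken.
  have supp_top : ∀ {i j : Fin 3} {p : Finset (Fin 3)} (hi : {i} ≤ p) (hj : {j} ≤ p)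
      (hp : p ≤ {0, 1, 2}) (_ : p ≠ {0}) (x : G {i}) (y : G {j}),
      (V p (γ _ _ hi x - γ _ _ hj y)⁺).supp =
        (V _ (γ _ _ (hi.trans hp) x - γ _ _ (hj.trans hp) y)⁺).supp := by
    intro i j p hi hj hp hp0 x y
    rw [γ_comp _ _ _ hi hp, γ_comp _ _ _ hj hp, ← map_sub, ← LGroupHom.map_posPart,
      supp_incl hp (top_gen ▸ Set.subset_univ _) (fun h => hp0 h.1)]
  have l12 : ({0, 1} : Finset (Fin 3)) ≤ {0, 1, 2} := by decide
  have l13 : ({0, 2} : Finset (Fin 3)) ≤ {0, 1, 2} := by decide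
  have l23 : ({1, 2} : Finset (Fin 3)) ≤ {0, 1, 2} := by decide
  have tri : ∀ p (x y z : G p), (V p (x - z)⁺).supp ⊆
      (V p (x - y)⁺).supp ∪ (V p (y - z)⁺).supp := fun p x y z =>
    V_add p _ _ _ (posPart_nonneg _) (posPart_nonneg _) (posPart_nonneg _) (posPart_sub_le x y z)
  have m1 := map_nonneg l1_12 hx₁
  have m2 := map_nonneg l2_12 hx₂
  have m1' := map_nonneg l1_13 hx₁
  have m3 := map_nonneg l3_13 hx₃
  refine false_of_differences
    (I₁₂ := V {0, 1} (γ _ _ l1_12 x₁ - γ _ _ l2_12 x₂)⁺)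
    (I₂₁ := V {0, 1} (γ _ _ l2_12 x₂ - γ _ _ l1_12 x₁)⁺)
    (I₁₃ := V {0, 2} (γ _ _ l1_13 x₁ - γ _ _ l3_13 x₃)⁺)
    (I₃₁ := V {0, 2} (γ _ _ l3_13 x₃ - γ _ _ l1_13 x₁)⁺)
    (I₂₃ := V {1, 2} (γ _ _ l2_23 x₂ - γ _ _ l3_23 x₃)⁺) ?_ ?_ ?_ ?_ ?_ ?_ ?_ ?_
  · intro P hP
    rw [← s1_12] at hP
    rw [← s2_12]
    exact diff _ _ _ m1 m2 P hP
  · intro P hP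
    rw [← s2_12] at hP
    rw [← s1_12]
    exact diff _ _ _ m2 m1 P hP
  · intro P hP
    rw [← s1_13] at hP
    rw [← s3_13]
    exact diff _ _ _ m1' m3 P hP
  · intro P hP
    rw [← s3_13] at hP
    rw [← s1_13]
    exact diff _ _ _ m3 m1' P hP
  · exact V_disj _ _ _ (posPart_sub_inf_posPart_sub _ _)
  · exact V_disj _ _ _ (posPart_sub_inf_posPart_sub _ _)
  · rw [supp_top l1_13 l3_13 l13 (by decide), supp_top l1_12 l2_12 l12 (by decide),
      supp_top l2_23 l3_23 l23 (by decide)]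
    exact tri _ _ _ _
  · rw [supp_top l1_13 l3_13 l13 (by decide), supp_top l2_12 l1_12 l12 (by decide),
      supp_top l2_23 l3_23 l23 (by decide)]
    exact tri _ _ _ _

/-! ### Principal convex `ℓ`-subgroups and `ℓ`-ideals -/

section Principal

variable {G : Type*} [AddGroup G] [Lattice G]

/-- The convex `ℓ`-subgroup generated by an element. -/
def Csc.principal (x : G) : Csc G := ⟨convexLClosure {x}, {x}, Set.finite_singleton x, rfl⟩

/-- The `ℓ`-ideal generated by an element. -/
def Idc.principal (x : G) : Idc G := ⟨lIdealClosure {x}, {x}, Set.finite_singleton x, rfl⟩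

lemma Csc.map_principal {H : Type*} [AddGroup H] [Lattice H] (f : LGroupHom G H) (x : G) :
    Csc.map f (Csc.principal x) = Csc.principal (f x) :=
  Subtype.ext ((convexLClosure_image f {x}).trans (by rw [Set.image_singleton]; rfl))

lemma Idc.map_principal {H : Type*} [AddGroup H] [Lattice H] (f : LGroupHom G H) (x : G) :
    Idc.map f (Idc.principal x) = Idc.principal (f x) :=
  Subtype.ext ((lIdealClosure_image f {x}).trans (by rw [Set.image_singleton]; rfl))

lemma Csc.isConvexLSubgroup (S : Csc G) : IsConvexLSubgroup S.1 := by
  obtain ⟨X, _, h⟩ := S.2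
  rw [h]
  exact isConvexLSubgroup_convexLClosure X

lemma Csc.isLUB_insert (x : G) {X : Set G} (hX : X.Finite) :
    IsLUB {Csc.principal x, ⟨convexLClosure X, X, hX, rfl⟩}
      ⟨convexLClosure (insert x X), insert x X, hX.insert x, rfl⟩ := by
  constructor
  · rintro _ (rfl | rfl)
    · exact convexLClosure_le (isConvexLSubgroup_convexLClosure _)
        (Set.singleton_subset_iff.2 (subset_convexLClosure _ (Set.mem_insert x X)))
    · exact convexLClosure_le (isConvexLSubgroup_convexLClosure _)
        ((Set.subset_insert x X).trans (subset_convexLClosure _))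
  · intro S hS
    have h₁ : Csc.principal x ≤ S := hS (Or.inl rfl)
    have h₂ : (⟨convexLClosure X, X, hX, rfl⟩ : Csc G) ≤ S := hS (Or.inr rfl)
    exact convexLClosure_le S.isConvexLSubgroup (Set.insert_subset
      (h₁ (subset_convexLClosure _ (Set.mem_singleton x)))
      ((subset_convexLClosure X).trans h₂))

lemma Idc.isLUB_insert (x : G) {X : Set G} (hX : X.Finite) :
    IsLUB {Idc.principal x, ⟨lIdealClosure X, X, hX, rfl⟩}
      ⟨lIdealClosure (insert x X), insert x X, hX.insert x, rfl⟩ := by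
  constructor
  · rintro _ (rfl | rfl)
    · exact lIdealClosure_le (isLIdeal_lIdealClosure _)
        (Set.singleton_subset_iff.2 (subset_lIdealClosure _ (Set.mem_insert x X)))
    · exact lIdealClosure_le (isLIdeal_lIdealClosure _)
        ((Set.subset_insert x X).trans (subset_lIdealClosure _))
  · intro S hS
    have h₁ : Idc.principal x ≤ S := hS (Or.inl rfl)
    have h₂ : (⟨lIdealClosure X, X, hX, rfl⟩ : Idc G) ≤ S := hS (Or.inr rfl)
    exact lIdealClosure_le S.isLIdeal (Set.insert_subset
      (h₁ (subset_lIdealClosure _ (Set.mem_singleton x)))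
      ((subset_lIdealClosure X).trans h₂))

lemma IsZeroLatticeHom.monotone {D E : Type*} [PartialOrder D] [OrderBot D] [PartialOrder E]
    [OrderBot E] {f : D → E} (hf : IsZeroLatticeHom f) : Monotone f := by
  intro x y h
  refine (hf.map_join x y y ⟨?_, fun z hz => hz (Or.inr rfl)⟩).1 (Or.inl rfl)
  rintro z (rfl | rfl)
  · exact h
  · exact le_rfl

lemma eq_bot_of_isLUB_bot {D : Type*} [PartialOrder D] [OrderBot D] {x y z : D}
    (h : IsLUB {x, y} z) (hx : x = ⊥) (hy : y = ⊥) : z = ⊥ :=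
  le_bot_iff.1 (h.2 (by rintro w (rfl | rfl) <;> simp [hx, hy]))

lemma Csc.supp_subset {p : Finset (Fin 3)} {η : Csc G → Idc (vecA p)} (hη : IsZeroLatticeHom η)
    {x y z : G} (hx : 0 ≤ x) (h : x ≤ y + z) :
    (η (Csc.principal x)).supp ⊆ (η (Csc.principal y)).supp ∪ (η (Csc.principal z)).supp := by
  refine subset_trans (Idc.supp_mono (hη.monotone ?_)) (Idc.supp_of_isLUB
    (hη.map_join _ _ _ (Csc.isLUB_insert y (Set.finite_singleton z))))
  refine convexLClosure_le (isConvexLSubgroup_convexLClosure _) (Set.singleton_subset_iff.2 ?_)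
  exact (isConvexLSubgroup_convexLClosure _).2.out (zero_mem _)
    (add_mem (subset_convexLClosure {y, z} (Or.inl rfl))
      (subset_convexLClosure {y, z} (Or.inr rfl))) ⟨hx, h⟩

lemma Idc.supp_subset {p : Finset (Fin 3)} {η : Idc G → Idc (vecA p)} (hη : IsZeroLatticeHom η)
    {x y z : G} (hx : 0 ≤ x) (h : x ≤ y + z) :
    (η (Idc.principal x)).supp ⊆ (η (Idc.principal y)).supp ∪ (η (Idc.principal z)).supp := by
  refine subset_trans (Idc.supp_mono (hη.monotone ?_)) (Idc.supp_of_isLUB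
    (hη.map_join _ _ _ (Idc.isLUB_insert y (Set.finite_singleton z))))
  refine lIdealClosure_le (isLIdeal_lIdealClosure _) (Set.singleton_subset_iff.2 ?_)
  exact (isLIdeal_lIdealClosure _).1.2.out (zero_mem _)
    (add_mem (subset_lIdealClosure {y, z} (Or.inl rfl))
      (subset_lIdealClosure {y, z} (Or.inr rfl))) ⟨hx, h⟩

/-- In a totally ordered factor, one of two disjoint elements is `0`, and conjugation preserves both
`0` and positivity. -/
lemma IsRepresentable.conj_inf_eq_zero (hG : IsRepresentable G) {x y : G} (h : x ⊓ y = 0) (g : G) :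
    (g + x + -g) ⊓ y = 0 := by
  obtain ⟨I, T, _, _, f, hT, -, hf⟩ := hG
  refine hf _ fun i => ?_
  have hi : f i x ⊓ f i y = 0 := by rw [← LGroupHom.map_inf, h, map_zero]
  rw [LGroupHom.map_inf, map_add, map_add, map_neg]
  have hx : 0 ≤ f i x := hi.symm.le.trans inf_le_left
  have hy : 0 ≤ f i y := hi.symm.le.trans inf_le_right
  have := (hT i).1
  have := (hT i).2
  rcases min_choice (f i x) (f i y) with h' | h'
  · rw [← h', show min (f i x) (f i y) = 0 from hi]
    simpa using hy
  · rw [← h', show min (f i x) (f i y) = 0 from hi]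
    refine inf_eq_right.2 ?_
    have := add_le_add_left (add_le_add_right hx (f i g)) (-(f i g))
    simpa using this

variable [AddLeftMono G] [AddRightMono G]

lemma IsConvexLSubgroup.abs_mem_iff {S : AddSubgroup G} (hS : IsConvexLSubgroup S) {x : G} :
    |x| ∈ S ↔ x ∈ S :=
  ⟨fun h => hS.2.out (neg_mem h) h ⟨neg_le.2 le_sup_right, le_sup_left⟩,
    fun h => (hS.1 x h _ (neg_mem h)).1⟩

lemma Csc.principal_abs (x : G) : Csc.principal |x| = Csc.principal x := by
  apply le_antisymm
  · exact convexLClosure_le (isConvexLSubgroup_convexLClosure _) (Set.singleton_subset_iff.2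
      ((isConvexLSubgroup_convexLClosure _).abs_mem_iff.2 (subset_convexLClosure _ rfl)))
  · exact convexLClosure_le (isConvexLSubgroup_convexLClosure _) (Set.singleton_subset_iff.2
      ((isConvexLSubgroup_convexLClosure _).abs_mem_iff.1 (subset_convexLClosure _ rfl)))

lemma Idc.principal_abs (x : G) : Idc.principal |x| = Idc.principal x := by
  apply le_antisymm
  · exact lIdealClosure_le (isLIdeal_lIdealClosure _) (Set.singleton_subset_iff.2
      ((isLIdeal_lIdealClosure _).1.abs_mem_iff.2 (subset_lIdealClosure _ rfl)))
  · exact lIdealClosure_le (isLIdeal_lIdealClosure _) (Set.singleton_subset_iff.2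
      ((isLIdeal_lIdealClosure _).1.abs_mem_iff.1 (subset_lIdealClosure _ rfl)))

/-- A finitely generated subgroup is a finite join of principal ones, so a join-preserving map
killing all of these is zero; passing to `|x|` makes the generator positive. -/
lemma Csc.exists_principal_ne_bot {E : Type*} [PartialOrder E] [OrderBot E] {η : Csc G → E}
    (hη : IsZeroLatticeHom η) (h : ∃ S, η S ≠ ⊥) :
    ∃ x : G, 0 ≤ x ∧ η (Csc.principal x) ≠ ⊥ := by
  by_contra! hn
  obtain ⟨⟨_, X, hX, rfl⟩, hS⟩ := h
  apply hS
  clear hS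
  induction X, hX using Set.Finite.induction_on with
  | empty => exact (congrArg η (le_bot_iff.1
      (convexLClosure_le isLIdeal_bot.1 (Set.empty_subset _)))).trans hη.map_bot
  | @insert x X _ hX ih =>
    refine eq_bot_of_isLUB_bot (hη.map_join _ _ _ (Csc.isLUB_insert x hX)) ?_ ih
    rw [← Csc.principal_abs]
    exact hn _ (abs_nonneg x)

lemma Idc.exists_principal_ne_bot {E : Type*} [PartialOrder E] [OrderBot E] {η : Idc G → E}
    (hη : IsZeroLatticeHom η) (h : ∃ S, η S ≠ ⊥) :
    ∃ x : G, 0 ≤ x ∧ η (Idc.principal x) ≠ ⊥ := by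
  by_contra! hn
  obtain ⟨⟨_, X, hX, rfl⟩, hS⟩ := h
  apply hS
  clear hS
  induction X, hX using Set.Finite.induction_on with
  | empty => exact (congrArg η (le_bot_iff.1
      (lIdealClosure_le isLIdeal_bot (Set.empty_subset _)))).trans hη.map_bot
  | @insert x X _ hX ih =>
    refine eq_bot_of_isLUB_bot (hη.map_join _ _ _ (Idc.isLUB_insert x hX)) ?_ ih
    rw [← Idc.principal_abs]
    exact hn _ (abs_nonneg x)

/-! ### Polars -/

lemma add_inf_eq_zero {x x' y : G} (hx : 0 ≤ x) (hx' : 0 ≤ x') (h : x ⊓ y = 0)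
    (h' : x' ⊓ y = 0) : (x + x') ⊓ y = 0 := by
  have hy : 0 ≤ y := h.symm.le.trans inf_le_right
  have h₁ : (x + x') ⊓ y ≤ x := by
    calc (x + x') ⊓ y ≤ (x + x') ⊓ (x + y) :=
          inf_le_inf_left _ (le_add_of_nonneg_left hx)
      _ = x + (x' ⊓ y) := (add_inf _ _ _).symm
      _ = x := by rw [h', add_zero]
  refine le_antisymm ?_ (le_inf (add_nonneg hx hx') hy)
  exact (le_inf h₁ inf_le_right).trans h.le

/-- The elements whose positive and negative parts are disjoint from `y`. -/
def polar (y : G) (hy : 0 ≤ y) : AddSubgroup G where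
  carrier := {z | z⁺ ⊓ y = 0 ∧ z⁻ ⊓ y = 0}
  zero_mem' := by simp [hy]
  add_mem' := by
    have key : ∀ {u v w : G}, u⁺ ⊓ y = 0 → v⁺ ⊓ y = 0 → w ≤ u + v → w⁺ ⊓ y = 0 := by
      intro u v w hu hv hw
      refine le_antisymm ?_ (le_inf (posPart_nonneg _) hy)
      refine le_trans (inf_le_inf_right y ?_)
        (add_inf_eq_zero (posPart_nonneg u) (posPart_nonneg v) hu hv).le
      exact sup_le (hw.trans (add_le_add (le_posPart _) (le_posPart _)))
        (add_nonneg (posPart_nonneg _) (posPart_nonneg _))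
    rintro u v ⟨hu, hu'⟩ ⟨hv, hv'⟩
    refine ⟨key hu hv le_rfl, ?_⟩
    rw [← posPart_neg] at hu' hv' ⊢
    -- Negation reverses the sum, hence the swapped arguments.
    exact key hv' hu' (neg_add_rev u v).le
  neg_mem' := by
    rintro u ⟨hu, hu'⟩
    exact ⟨by rwa [posPart_neg], by rwa [negPart_neg]⟩

lemma mem_polar {y : G} {hy : 0 ≤ y} {z : G} : z ∈ polar y hy ↔ z⁺ ⊓ y = 0 ∧ z⁻ ⊓ y = 0 :=
  Iff.rfl

lemma mem_polar_of_nonneg {y : G} {hy : 0 ≤ y} {z : G} (hz : 0 ≤ z) :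
    z ∈ polar y hy ↔ z ⊓ y = 0 := by
  rw [mem_polar, posPart_eq_self.2 hz, negPart_eq_zero.2 hz, inf_eq_left.2 hy, and_iff_left rfl]

lemma isConvexLSubgroup_polar {y : G} (hy : 0 ≤ y) : IsConvexLSubgroup (polar y hy) := by
  have conv : ((polar y hy : AddSubgroup G) : Set G).OrdConnected := by
    refine ⟨fun u hu v hv z hz => ⟨?_, ?_⟩⟩
    · exact le_antisymm ((inf_le_inf_right y (posPart_mono hz.2)).trans hv.1.le)
        (le_inf (posPart_nonneg _) hy)
    · exact le_antisymm ((inf_le_inf_right y (negPart_anti hz.1)).trans hu.2.le)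
        (le_inf (negPart_nonneg _) hy)
  have pos : ∀ u ∈ polar y hy, u⁺ ∈ polar y hy := fun u hu =>
    (mem_polar_of_nonneg (posPart_nonneg u)).2 hu.1
  have neg : ∀ u ∈ polar y hy, u⁻ ∈ polar y hy := fun u hu =>
    (mem_polar_of_nonneg (negPart_nonneg u)).2 hu.2
  refine ⟨fun u hu v hv => ⟨?_, ?_⟩, conv⟩
  -- Convexity reduces closure under `⊔` to the bounds `u ≤ u ⊔ v ≤ u⁺ + v⁺`; closure under `⊓` is
  -- dual.
  · refine conv.out hu (add_mem (pos u hu) (pos v hv)) ⟨le_sup_left, sup_le ?_ ?_⟩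
    · exact (le_posPart u).trans (le_add_of_nonneg_right (posPart_nonneg v))
    · exact (le_posPart v).trans (le_add_of_nonneg_left (posPart_nonneg u))
  · refine conv.out (neg_mem (add_mem (neg v hv) (neg u hu))) hu ⟨le_inf ?_ ?_, inf_le_left⟩
    · rw [neg_le]
      exact (neg_le_negPart u).trans (le_add_of_nonneg_left (negPart_nonneg v))
    · rw [neg_le]
      exact (neg_le_negPart v).trans (le_add_of_nonneg_right (negPart_nonneg u))

/-- Two applications of polars: for `z` in both subgroups, `|z|` lies in the polar of `y`, so `y`
lies in the polar of `|z|`. Then `|z|` is disjoint from itself, hence zero. -/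
lemma convexLClosure_inf_eq_bot {x y : G} (h : x ⊓ y = 0) :
    convexLClosure {x} ⊓ convexLClosure {y} = ⊥ := by
  have hx : 0 ≤ x := h.symm.le.trans inf_le_left
  have hy : 0 ≤ y := h.symm.le.trans inf_le_right
  rw [eq_bot_iff]
  rintro z ⟨hzx, hzy⟩
  have habs : |z| ⊓ y = 0 := (mem_polar_of_nonneg (hy := hy) (abs_nonneg z)).1
    (convexLClosure_le (isConvexLSubgroup_polar hy)
      (Set.singleton_subset_iff.2 ((mem_polar_of_nonneg hx).2 h))
      ((isConvexLSubgroup_convexLClosure _).abs_mem_iff.2 hzx))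
  have habs' : |z| ⊓ |z| = 0 := (mem_polar_of_nonneg (hy := abs_nonneg z) (abs_nonneg z)).1
    (convexLClosure_le (isConvexLSubgroup_polar _)
      (Set.singleton_subset_iff.2 ((mem_polar_of_nonneg hy).2 (by rwa [inf_comm])))
      ((isConvexLSubgroup_convexLClosure _).abs_mem_iff.2 hzy))
  rw [inf_idem] at habs'
  exact (isLIdeal_bot (G := G)).1.abs_mem_iff.1 habs'

lemma posPart_conj (g x : G) : (g + x + -g)⁺ = g + x⁺ + -g := by
  rw [posPart_def, posPart_def, add_sup, sup_add, add_zero, add_neg_cancel]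

/-- Normality is the point: it lets the double polar argument run with `ℓ`-ideals in place of convex
`ℓ`-subgroups. -/
lemma IsRepresentable.isLIdeal_polar (hG : IsRepresentable G) {y : G} (hy : 0 ≤ y) :
    IsLIdeal (polar y hy) := by
  refine ⟨isConvexLSubgroup_polar hy, ⟨fun u hu g => ⟨?_, ?_⟩⟩⟩
  · rw [posPart_conj]
    exact hG.conj_inf_eq_zero hu.1 g
  · have : -(g + u + -g) = g + -u + -g := by simp [add_assoc]
    rw [← posPart_neg, this, posPart_conj, posPart_neg]
    exact hG.conj_inf_eq_zero hu.2 g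

lemma IsRepresentable.lIdealClosure_inf_eq_bot (hG : IsRepresentable G) {x y : G}
    (h : x ⊓ y = 0) : lIdealClosure {x} ⊓ lIdealClosure {y} = ⊥ := by
  have hx : 0 ≤ x := h.symm.le.trans inf_le_left
  have hy : 0 ≤ y := h.symm.le.trans inf_le_right
  rw [eq_bot_iff]
  rintro z ⟨hzx, hzy⟩
  have habs : |z| ⊓ y = 0 := (mem_polar_of_nonneg (hy := hy) (abs_nonneg z)).1
    (lIdealClosure_le (hG.isLIdeal_polar hy)
      (Set.singleton_subset_iff.2 ((mem_polar_of_nonneg hx).2 h))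
      ((isLIdeal_lIdealClosure _).1.abs_mem_iff.2 hzx))
  have habs' : |z| ⊓ |z| = 0 := (mem_polar_of_nonneg (hy := abs_nonneg z) (abs_nonneg z)).1
    (lIdealClosure_le (hG.isLIdeal_polar _)
      (Set.singleton_subset_iff.2 ((mem_polar_of_nonneg hy).2 (by rwa [inf_comm])))
      ((isLIdeal_lIdealClosure _).1.abs_mem_iff.2 hzy))
  rw [inf_idem] at habs'
  exact (isLIdeal_bot (G := G)).1.abs_mem_iff.1 habs'

lemma Csc.isGLB_principal {x y : G} (h : x ⊓ y = 0) :
    IsGLB {Csc.principal x, Csc.principal y} ⊥ :=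
  ⟨fun _ _ => bot_le, fun _ hS => (le_inf (hS (Or.inl rfl)) (hS (Or.inr rfl))).trans
    (convexLClosure_inf_eq_bot h).le⟩

lemma IsRepresentable.isGLB_principal (hG : IsRepresentable G) {x y : G} (h : x ⊓ y = 0) :
    IsGLB {Idc.principal x, Idc.principal y} ⊥ :=
  ⟨fun _ _ => bot_le, fun _ hS => (le_inf (hS (Or.inl rfl)) (hS (Or.inr rfl))).trans
    (hG.lIdealClosure_inf_eq_bot h).le⟩

end Principal

/-! ### The two cases of the theorem -/

theorem theorem5p13 {G : Finset (Fin 3) → Type*} [∀ p, AddGroup (G p)] [∀ p, Lattice (G p)]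
    [∀ p, AddLeftMono (G p)] [∀ p, AddRightMono (G p)]
    (γ : ∀ p q : Finset (Fin 3), p ≤ q → LGroupHom (G p) (G q))
    (γ_id : ∀ (p : Finset (Fin 3)) (x : G p), γ p p le_rfl x = x)
    (γ_comp : ∀ (p q r : Finset (Fin 3)) (hpq : p ≤ q) (hqr : q ≤ r) (x : G p),
      γ p r (hpq.trans hqr) x = γ q r hqr (γ p q hpq x)) :
    (∀ η : ∀ p, Csc (G p) → Idc (vecA p),
      (∀ p, IsZeroLatticeHom (η p)) →
      (∀ (p q : Finset (Fin 3)) (hpq : p ≤ q), ∀ f ∈ vecAArrows p q, ∀ x : Csc (G p),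
        η q (Csc.map (γ p q hpq) x) = Idc.map f (η p x)) →
      ∃ i : Fin 3, ∀ x : Csc (G {i}), η {i} x = ⊥) ∧
    ((∀ p, IsRepresentable (G p)) →
      ∀ η : ∀ p, Idc (G p) → Idc (vecA p),
      (∀ p, IsZeroLatticeHom (η p)) →
      (∀ (p q : Finset (Fin 3)) (hpq : p ≤ q), ∀ f ∈ vecAArrows p q, ∀ x : Idc (G p),
        η q (Idc.map (γ p q hpq) x) = Idc.map f (η p x)) →
      ∃ i : Fin 3, ∀ x : Idc (G {i}), η {i} x = ⊥) := by
  constructor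
  · intro η hη hnat
    by_contra! hn
    refine false_of_diagram γ γ_comp (fun p x => η p (Csc.principal x))
      (fun p x y z hx _ _ h => Csc.supp_subset (hη p) hx h) (fun p x y h P => ?_)
      (fun p q hpq f hf x => ?_) (fun i => Csc.exists_principal_ne_bot (hη {i}) (hn i))
    · refine Idc.supp_disjoint_of_isGLB ?_
      rw [← (hη p).map_bot]
      exact (hη p).map_meet _ _ _ (Csc.isGLB_principal h)
    · rw [← hnat p q hpq f hf, Csc.map_principal]
  · intro hG η hη hnat
    by_contra! hn
    refine false_of_diagram γ γ_comp (fun p x => η p (Idc.principal x))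
      (fun p x y z hx _ _ h => Idc.supp_subset (hη p) hx h) (fun p x y h P => ?_)
      (fun p q hpq f hf x => ?_) (fun i => Idc.exists_principal_ne_bot (hη {i}) (hn i))
    · refine Idc.supp_disjoint_of_isGLB ?_
      rw [← (hη p).map_bot]
      exact (hη p).map_meet _ _ _ ((hG p).isGLB_principal h)
    · rw [← hnat p q hpq f hf, Idc.map_principal]
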